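/- **Setting.** For $n\ge 1$ one observes the Gaussian sequence $X=(X_k)_{k\ge1}$, $X_k=f_{0,k}+n^{-1/2}\xi_k$, with $\xi_k$ independent $\mathcal N(0,1)$; $f_0=(f_{0,k})_{k\ge1}\in\ell_2$ is the sequence of coefficients of the true $L_2([0,1])$ function in a fixed orthonormal basis, and $E_{f_0}$ is the expectation under this law of $X$. Write $\|f\|_2=(\sum_k f_k^2)^{1/2}\in[0,\infty]$ and, for $\beta,F>0$, $\mathcal S^\beta(F)=\{f:\sum_{k\ge1}k^{2\beta}f_k^2\le F^2\}$. Let $h$ be a probability density on $\mathbb R$ for which there are $c_1,c_2>0$, $\kappa\ge0$ such that: $h$ is symmetric, positive, and non-increasing on $(0,\infty)$ (it may be unbounded near $0$); $\log(1/h(x))\le c_1(1+\log^{1+\kappa}(1+x))$ for all $x>0$; and $\int_x^\infty h(u)\,du\le c_2/x$ for all $x\ge1$. For $\alpha>0$ the $\mathrm{HT}(\alpha)$ prior $\Pi$ is the law of $(\sigma_k\zeta_k)_{k\ge1}$, where $\sigma_k=k^{-1/2-\alpha}$ and the $\zeta_k$ are i.i.d. with density $h$. The posterior $\Pi[\,\cdot\,|\,X]$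 is the probability measure on sequences given by Bayes' formula $$\Pi[B\,|\,X]=\frac{\int_B\exp\{-\frac n2\sum_{k}(X_k-f_k)^2\}\,d\Pi(f)}{\int\exp\{-\frac n2\sum_{k}(X_k-f_k)^2\}\,d\Pi(f)},$$ where, for events $B$ depending on finitely many coordinates, the right-hand side is understood as the limit as $K\to\infty$ of the same ratio with the sums restricted to $k\le K$; these values determine the measure. **Theorem.** Let $0<\alpha<\beta$, $F>0$, and let $\Pi$ be the $\mathrm{HT}(\alpha)$ prior with density $h$ as above. (i) If moreover $\alpha>1/2$, there is $\delta_0>0$ (not depending on the choice of $f_0$ in $\mathcal S^\beta(F)$) such that for all $\delta\ge\delta_0$ and all $f_0\in\mathcal S^\beta(F)$, with $\varphi_n=n^{-\alpha/(2\alpha+1)}(\log n)^{-\delta}$, $$E_{f_0}\,\Pi\big[\{f:\|f-f_0\|_2\le\varphi_n\}\,\big|\,X\big]\longrightarrow0\qquad(n\to\infty).$$ (ii) For all $0<\alpha<\beta$ there is $c>0$ (not depending on the choice of $f_0$ in $\mathcal S^\beta(F)$) such that for every $f_0\in\mathcal S^\beta(F)$ and all sufficiently large $n$, $$E_{f_0}\int\|f-f_0\|_2^2\,d\Pi(f\,|\,X)\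 \ge\ c\,n^{-2\alpha/(2\alpha+1)}.$$ -/

import Mathlib

open MeasureTheory ProbabilityTheory Filter Topology
open scoped ENNReal NNReal

namespace SeqModel

noncomputable section

/-! Sequences are indexed by `k : ℕ`; the entry with index `k` is the `(k + 1)`-st coefficient
in the orthonormal basis, so that powers of the frequency are powers of `k + 1`. -/

/-- The `ℓ²` norm of a real sequence, with value `∞` if the sequence is not square summable. -/
def l2norm (f : ℕ → ℝ) : ℝ≥0∞ := (∑' k, ENNReal.ofReal (f k ^ 2)) ^ (1 / 2 : ℝ)

/-- The Sobolev ball of smoothness `β` and radius `F`: `∑ₖ k ^ (2 β) fₖ² ≤ F²`. -/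
def sobolevBall (β F : ℝ) : Set (ℕ → ℝ) :=
  {f | ∑' k : ℕ, ENNReal.ofReal (((k : ℝ) + 1) ^ (2 * β) * f k ^ 2) ≤ ENNReal.ofReal (F ^ 2)}

/-- The law of the data `Xₖ = fₖ + ξₖ / √n`, with `ξₖ` independent standard Gaussian. -/
def dataLaw (n : ℕ) (f : ℕ → ℝ) : Measure (ℕ → ℝ) :=
  Measure.infinitePi fun k => gaussianReal (f k) ((n : ℝ≥0)⁻¹)

/-- Heavy-tailed probability densities. The value `h 0` is left unconstrained, so that densities
which are unbounded near the origin are included. -/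
structure IsHeavyTailed (h : ℝ → ℝ) : Prop where
  measurable : Measurable h
  lintegral_eq_one : ∫⁻ x, ENNReal.ofReal (h x) = 1
  symm : ∀ x, h (-x) = h x
  pos : ∀ x, x ≠ 0 → 0 < h x
  anti : AntitoneOn h (Set.Ioi 0)
  log_le : ∃ c₁ > 0, ∃ κ ≥ 0, ∀ x > 0,
    Real.log (1 / h x) ≤ c₁ * (1 + Real.log (1 + x) ^ (1 + κ))
  tail_le : ∃ c₂ > 0, ∀ x ≥ 1, ∫ u in Set.Ioi x, h u ≤ c₂ / x

/-- The probability measure on `ℝ` with density `h`. -/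
def densityLaw (h : ℝ → ℝ) : Measure ℝ := volume.withDensity fun x => ENNReal.ofReal (h x)

/-- The polynomial scalings `σₖ = k ^ (-1/2 - α)`. -/
def scaling (α : ℝ) (k : ℕ) : ℝ := ((k : ℝ) + 1) ^ (-(1 / 2) - α)

/-- The `HT(α)` prior: the law of `(σₖ ζₖ)ₖ`, with `ζₖ` i.i.d. of density `h`. -/
def htPrior (h : ℝ → ℝ) (α : ℝ) : Measure (ℕ → ℝ) :=
  (Measure.infinitePi fun _ : ℕ => densityLaw h).map fun ζ k => scaling α k * ζ k

/-- `exp (-(n/2) ∑_{k < K} (xₖ - fₖ)²)`. -/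
def likelihood (n : ℕ) (x : ℕ → ℝ) (K : ℕ) (f : ℕ → ℝ) : ℝ≥0∞ :=
  ENNReal.ofReal (Real.exp (-((n : ℝ) / 2) * ∑ k ∈ Finset.range K, (x k - f k) ^ 2))

/-- Bayes' formula for the prior `Π`, with the sum in the exponent cut at `K` terms. -/
def bayes (Pi : Measure (ℕ → ℝ)) (n : ℕ) (x : ℕ → ℝ) (K : ℕ) (B : Set (ℕ → ℝ)) : ℝ≥0∞ :=
  (∫⁻ f in B, likelihood n x K f ∂Pi) / ∫⁻ f, likelihood n x K f ∂Pi

/-- The probability measure `ρ` on sequence space is given by Bayes' formula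
`ρ B = ∫_B exp (-(n/2) ∑ₖ (xₖ - fₖ)²) dΠ(f) / ∫ exp (-(n/2) ∑ₖ (xₖ - fₖ)²) dΠ(f)`.
Under the model the infinite sum diverges and both integrals vanish, so the quotient is read as the
limit of the quotients with partial sums, for the events `B` that depend on finitely many
coordinates; these events determine `ρ`. -/
def IsPosterior (Pi : Measure (ℕ → ℝ)) (n : ℕ) (x : ℕ → ℝ) (ρ : Measure (ℕ → ℝ)) : Prop :=
  IsProbabilityMeasure ρ ∧ ∀ B ∈ measurableCylinders (fun _ : ℕ => ℝ),
    Tendsto (fun K => bayes Pi n x K B) atTop (𝓝 (ρ B))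

open Classical in
/-- The posterior `Π(· | X = x)`. For a prior with independent coordinates it always exists, and it
is the product of the posteriors of the coordinates (see `posterior_htPrior`). -/
def posterior (Pi : Measure (ℕ → ℝ)) (n : ℕ) (x : ℕ → ℝ) : Measure (ℕ → ℝ) :=
  if H : ∃ ρ, IsPosterior Pi n x ρ then H.choose else 0

/-! Existence and uniqueness of the posterior for product priors. -/

theorem IsPosterior.unique {Pi : Measure (ℕ → ℝ)} {n : ℕ} {x : ℕ → ℝ} {ρ ρ' : Measure (ℕ → ℝ)}
    (h : IsPosterior Pi n x ρ) (h' : IsPosterior Pi n x ρ') : ρ = ρ' := by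
  have := h.1
  have := h'.1
  refine ext_of_generate_finite _ generateFrom_measurableCylinders.symm
    isPiSystem_measurableCylinders (fun B hB => ?_) (by simp)
  exact tendsto_nhds_unique (h.2 B hB) (h'.2 B hB)

theorem posterior_eq {Pi : Measure (ℕ → ℝ)} {n : ℕ} {x : ℕ → ℝ} {ρ : Measure (ℕ → ℝ)}
    (h : IsPosterior Pi n x ρ) : posterior Pi n x = ρ := by
  have H : ∃ ρ, IsPosterior Pi n x ρ := ⟨ρ, h⟩
  rw [posterior, dif_pos H]
  exact H.choose_spec.unique h

/-- The posterior of one coordinate with prior `μ` and observation `y`. -/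
def coordPosterior (μ : Measure ℝ) (n : ℕ) (y : ℝ) : Measure ℝ :=
  μ.tilted fun t => -((n : ℝ) / 2) * (y - t) ^ 2

theorem integrable_coord (μ : Measure ℝ) [IsProbabilityMeasure μ] (n : ℕ) (y : ℝ) :
    Integrable (fun t => Real.exp (-((n : ℝ) / 2) * (y - t) ^ 2)) μ := by
  refine Integrable.of_bound (C := 1) (by fun_prop) (ae_of_all _ fun t => ?_)
  rw [Real.norm_eq_abs, abs_of_pos (Real.exp_pos _), Real.exp_le_one_iff]
  have : 0 ≤ ((n : ℝ) / 2) * (y - t) ^ 2 := by positivity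
  linarith

instance (μ : Measure ℝ) [IsProbabilityMeasure μ] (n : ℕ) (y : ℝ) :
    IsProbabilityMeasure (coordPosterior μ n y) :=
  isProbabilityMeasure_tilted (integrable_coord μ n y)

theorem coordPosterior_apply (μ : Measure ℝ) [IsProbabilityMeasure μ] (n : ℕ) (y : ℝ)
    {s : Set ℝ} (hs : MeasurableSet s) :
    coordPosterior μ n y s =
      (∫⁻ t in s, ENNReal.ofReal (Real.exp (-((n : ℝ) / 2) * (y - t) ^ 2)) ∂μ) /
        ∫⁻ t, ENNReal.ofReal (Real.exp (-((n : ℝ) / 2) * (y - t) ^ 2)) ∂μ := by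
  have hi := integrable_coord μ n y
  rw [coordPosterior, tilted_apply' _ _ hs,
    ← ofReal_integral_eq_lintegral_ofReal hi (ae_of_all _ fun t => (Real.exp_pos _).le)]
  simp_rw [ENNReal.ofReal_div_of_pos (integral_exp_pos hi), div_eq_mul_inv]
  rw [lintegral_mul_const _ (by fun_prop)]

theorem likelihood_eq_prod (n : ℕ) (x : ℕ → ℝ) (K : ℕ) (f : ℕ → ℝ) :
    likelihood n x K f = ∏ k ∈ Finset.range K,
      ENNReal.ofReal (Real.exp (-((n : ℝ) / 2) * (x k - f k) ^ 2)) := by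
  rw [likelihood, Finset.mul_sum, Real.exp_sum,
    ENNReal.ofReal_prod_of_nonneg fun _ _ => (Real.exp_pos _).le]

theorem measurable_likelihood (n : ℕ) (x : ℕ → ℝ) (K : ℕ) : Measurable (likelihood n x K) := by
  unfold likelihood
  fun_prop

theorem lintegral_box (μ : ℕ → Measure ℝ) [∀ k, IsProbabilityMeasure (μ k)] (n : ℕ) (x : ℕ → ℝ)
    (K : ℕ) (s : Finset ℕ) (t : ℕ → Set ℝ) (ht : ∀ k, MeasurableSet (t k)) :
    ∫⁻ f in (s : Set ℕ).pi t, likelihood n x K f ∂(Measure.infinitePi μ) =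
      ∏ k ∈ s ∪ Finset.range K, ∫⁻ u in (if k ∈ s then t k else Set.univ),
        (if k < K then ENNReal.ofReal (Real.exp (-((n : ℝ) / 2) * (x k - u) ^ 2)) else 1) ∂(μ k) := by
  classical
  set T : ℕ → Set ℝ := fun k => if k ∈ s then t k else Set.univ with hT
  have hTm : ∀ k, MeasurableSet (T k) := fun k => by
    simp only [hT]; split_ifs
    exacts [ht k, MeasurableSet.univ]
  set e : ℕ → ℝ → ℝ≥0∞ := fun k u =>
    if k < K then ENNReal.ofReal (Real.exp (-((n : ℝ) / 2) * (x k - u) ^ 2)) else 1 with he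
  have hem : ∀ k, Measurable (e k) := fun k => by
    simp only [he]; split_ifs
    exacts [by fun_prop, measurable_const]
  have hbox : MeasurableSet ((s : Set ℕ).pi t) := .pi s.countable_toSet fun k _ => ht k
  rw [← lintegral_indicator hbox]
  have key : ∀ f : ℕ → ℝ, ((s : Set ℕ).pi t).indicator (likelihood n x K) f =
      ∏ k ∈ s ∪ Finset.range K, (T k).indicator (e k) (f k) := by
    intro f
    by_cases hf : f ∈ (s : Set ℕ).pi t
    · rw [Set.indicator_of_mem hf, likelihood_eq_prod]
      have h1 : ∀ k ∈ s ∪ Finset.range K, (T k).indicator (e k) (f k) = e k (f k) := by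
        intro k _
        refine Set.indicator_of_mem ?_ _
        by_cases hk : k ∈ s
        · simpa [hT, hk] using hf k hk
        · simp [hT, hk]
      rw [Finset.prod_congr rfl h1]
      have h2 : ∀ k ∈ Finset.range K,
          ENNReal.ofReal (Real.exp (-((n : ℝ) / 2) * (x k - f k) ^ 2)) = e k (f k) := by
        intro k hk
        simp [he, Finset.mem_range.1 hk]
      rw [Finset.prod_congr rfl h2]
      refine Finset.prod_subset Finset.subset_union_right fun k _ hk => ?_
      have : ¬ k < K := by simpa using hk
      simp [he, this]
    · rw [Set.indicator_of_notMem hf]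
      obtain ⟨k, hk, hkf⟩ : ∃ k ∈ s, f k ∉ t k := by
        simpa [Set.mem_pi] using hf
      refine (Finset.prod_eq_zero (Finset.mem_union_left _ hk) ?_).symm
      exact Set.indicator_of_notMem (by simpa [hT, hk] using hkf) _
  simp_rw [key]
  have hind : iIndepFun (fun k (f : ℕ → ℝ) => (T k).indicator (e k) (f k))
      (Measure.infinitePi μ) :=
    iIndepFun_infinitePi (P := μ) (X := fun k => (T k).indicator (e k))
      fun k => (hem k).indicator (hTm k)
  rw [lintegral_prod_eq_prod_lintegral_of_indepFun _ _ hind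
    fun k => ((hem k).indicator (hTm k)).comp (measurable_pi_apply k)]
  refine Finset.prod_congr rfl fun k _ => ?_
  rw [← lintegral_indicator (hTm k), ← (measurePreserving_eval_infinitePi μ k).lintegral_comp
    ((hem k).indicator (hTm k))]

theorem bayes_eq (μ : ℕ → Measure ℝ) [∀ k, IsProbabilityMeasure (μ k)] (n : ℕ) (x : ℕ → ℝ)
    (K : ℕ) {B : Set (ℕ → ℝ)} (hB : MeasurableSet B) :
    bayes (Measure.infinitePi μ) n x K B =
      Measure.infinitePi (fun k => if k < K then coordPosterior (μ k) n (x k) else μ k) B := by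
  classical
  have : ∀ k, IsProbabilityMeasure (if k < K then coordPosterior (μ k) n (x k) else μ k) := by
    intro k; split_ifs <;> infer_instance
  set ν := (∫⁻ f, likelihood n x K f ∂(Measure.infinitePi μ))⁻¹ •
    (Measure.infinitePi μ).withDensity (likelihood n x K) with hν
  have hνB : ∀ {B : Set (ℕ → ℝ)}, MeasurableSet B → ν B = bayes (Measure.infinitePi μ) n x K B := by
    intro B hB
    rw [hν, Measure.smul_apply, withDensity_apply _ hB, smul_eq_mul, bayes, mul_comm,
      div_eq_mul_inv]
  rw [← hνB hB]
  congr 1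
  refine Measure.eq_infinitePi _ fun s t ht => ?_
  rw [hνB (.pi s.countable_toSet fun k _ => ht k), bayes, lintegral_box μ n x K s t ht]
  have huniv := lintegral_box μ n x K s (fun _ => Set.univ) fun _ => MeasurableSet.univ
  have hpu : (s : Set ℕ).pi (fun _ => (Set.univ : Set ℝ)) = Set.univ := by ext; simp
  rw [hpu, setLIntegral_univ] at huniv
  simp only [ite_self, Measure.restrict_univ] at huniv
  rw [huniv]
  have hfin : ∀ k, ∫⁻ u, (if k < K then
      ENNReal.ofReal (Real.exp (-((n : ℝ) / 2) * (x k - u) ^ 2)) else 1) ∂(μ k) ≠ ∞ := by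
    intro k
    split_ifs
    · exact (integrable_coord (μ k) n (x k)).lintegral_lt_top.ne
    · simp
  rw [← ENNReal.prod_div_distrib fun _ _ k _ _ => Or.inr (hfin k)]
  rw [← Finset.prod_subset (Finset.subset_union_left (s₂ := Finset.range K))]
  · refine Finset.prod_congr rfl fun k hk => ?_
    by_cases hkK : k < K
    · simp only [hk, hkK, if_true]
      rw [coordPosterior_apply _ _ _ (ht k)]
    · simp [hk, hkK]
  · intro k hk hks
    have hkK : k < K := by
      simpa [hks] using hk
    simp only [hks, hkK, if_true, if_false, Measure.restrict_univ]
    have h1 := coordPosterior_apply (μ k) n (x k) MeasurableSet.univ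
    rw [measure_univ, setLIntegral_univ] at h1
    exact h1.symm

theorem isPosterior_infinitePi (μ : ℕ → Measure ℝ) [∀ k, IsProbabilityMeasure (μ k)] (n : ℕ)
    (x : ℕ → ℝ) : IsPosterior (Measure.infinitePi μ) n x
      (Measure.infinitePi fun k => coordPosterior (μ k) n (x k)) := by
  refine ⟨inferInstance, fun B hB => ?_⟩
  obtain ⟨s, S, hS, rfl⟩ := (mem_measurableCylinders B).1 hB
  refine tendsto_const_nhds.congr' ?_
  filter_upwards [eventually_gt_atTop (s.sup id)] with K hK
  have : ∀ k, IsProbabilityMeasure (if k < K then coordPosterior (μ k) n (x k) else μ k) := by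
    intro k; split_ifs <;> infer_instance
  rw [bayes_eq μ n x K hS.cylinder, Measure.infinitePi_cylinder _ hS,
    Measure.infinitePi_cylinder _ hS]
  congr 2
  funext k
  have : (k : ℕ) < K := (Finset.le_sup (f := id) k.2).trans_lt hK
  simp [this]

theorem IsHeavyTailed.isProbabilityMeasure {h : ℝ → ℝ} (hh : IsHeavyTailed h) :
    IsProbabilityMeasure (densityLaw h) :=
  ⟨by rw [densityLaw, withDensity_apply _ MeasurableSet.univ, setLIntegral_univ,
    hh.lintegral_eq_one]⟩

theorem htPrior_eq {h : ℝ → ℝ} (hh : IsHeavyTailed h) (α : ℝ) :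
    htPrior h α = Measure.infinitePi fun k => (densityLaw h).map (scaling α k * ·) := by
  have := hh.isProbabilityMeasure
  exact Measure.infinitePi_map_pi (fun _ : ℕ => densityLaw h) fun k => measurable_const_mul _

theorem posterior_htPrior {h : ℝ → ℝ} (hh : IsHeavyTailed h) (α : ℝ) (n : ℕ) (x : ℕ → ℝ) :
    IsPosterior (htPrior h α) n x (posterior (htPrior h α) n x) ∧
    posterior (htPrior h α) n x = Measure.infinitePi fun k =>
      coordPosterior ((densityLaw h).map (scaling α k * ·)) n (x k) := by
  have := hh.isProbabilityMeasure
  have (k : ℕ) : IsProbabilityMeasure ((densityLaw h).map (scaling α k * ·)) :=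
    Measure.isProbabilityMeasure_map (measurable_const_mul _).aemeasurable
  have H := isPosterior_infinitePi (fun k => (densityLaw h).map (scaling α k * ·)) n x
  rw [← htPrior_eq hh] at H
  rw [posterior_eq H]
  exact ⟨H, rfl⟩

end

end SeqModel

namespace SeqModel

/-! Put `N = n ^ (1 / (2α + 1))`. At frequencies of order `N` the prior scale is comparable to the
noise level: `√n σₖ` lies between two positive constants. There the data cannot override the prior.
If `n θ² < 1`, then with probability bounded below `|√n y| ≤ 2`, and the posterior of that
coordinate keeps a fixed share of its mass at distance at least `1 / √n` from the truth `θ`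
(`exists_le_lintegral_coordPosterior`). The bound has the form `c (1 - n θ²)`, which holds trivially
for large `θ` and can be summed: since `β > α`, `n ∑ f₀ₖ²` over the block is `o(N)`, so the total is
at least `c N / 2` (`eventually_le_sum_block`).

For the risk, each coordinate contributes at least `1 / n` times this mass, and `N / n = n ^ (-2α /
(2α + 1))`. For the ball, prior and noise are products, so the exponential moment `exp (-n ∑ (fₖ -
f₀ₖ)²)` factorizes, and each factor is at most `exp (-d (1 - n f₀ₖ²))` with `d > 0` fixed. Markov's
inequality bounds the expected mass of the ball of radius `r` by `exp (n r² - d N / 2)`, and `n φₙ²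
= N (log n) ^ (-2δ) = o(N)`. -/

/-! ### Partial sums of squares and integrals against product measures. -/

theorem l2norm_sq (f : ℕ → ℝ) : l2norm f ^ 2 = ∑' k, ENNReal.ofReal (f k ^ 2) := by
  rw [l2norm, ← ENNReal.rpow_natCast, ← ENNReal.rpow_mul]
  norm_num

theorem sum_sq_le_of_l2norm_le {f : ℕ → ℝ} {r : ℝ} (hr : 0 ≤ r)
    (hf : l2norm f ≤ ENNReal.ofReal r) (s : Finset ℕ) : ∑ k ∈ s, f k ^ 2 ≤ r ^ 2 := by
  have h1 : ∑ k ∈ s, ENNReal.ofReal (f k ^ 2) ≤ ENNReal.ofReal (r ^ 2) :=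
    calc _ ≤ ∑' k, ENNReal.ofReal (f k ^ 2) := ENNReal.sum_le_tsum s
      _ = l2norm f ^ 2 := (l2norm_sq f).symm
      _ ≤ ENNReal.ofReal r ^ 2 := by gcongr
      _ = _ := (ENNReal.ofReal_pow hr 2).symm
  rwa [← ENNReal.ofReal_sum_of_nonneg fun _ _ => sq_nonneg _,
    ENNReal.ofReal_le_ofReal_iff (sq_nonneg r)] at h1

theorem sum_sq_le_of_mem_sobolevBall {β F N : ℝ} (hβ : 0 ≤ β) (hN : 0 < N) {f : ℕ → ℝ}
    (hf : f ∈ sobolevBall β F) {s : Finset ℕ} (hs : ∀ k ∈ s, N ≤ (k : ℝ) + 1) :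
    ∑ k ∈ s, f k ^ 2 ≤ F ^ 2 * N ^ (-(2 * β)) := by
  have h1 : ∑ k ∈ s, ENNReal.ofReal (((k : ℝ) + 1) ^ (2 * β) * f k ^ 2) ≤ ENNReal.ofReal (F ^ 2) :=
    (ENNReal.sum_le_tsum s).trans hf
  rw [← ENNReal.ofReal_sum_of_nonneg fun _ _ => by positivity,
    ENNReal.ofReal_le_ofReal_iff (sq_nonneg F)] at h1
  rw [Real.rpow_neg hN.le, ← div_eq_mul_inv, le_div_iff₀ (by positivity), Finset.sum_mul]
  refine le_trans (Finset.sum_le_sum fun k hk => ?_) h1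
  rw [mul_comm]
  gcongr
  exact hs k hk

theorem measurable_lintegral_coordPosterior (μ : Measure ℝ) [IsProbabilityMeasure μ] (n : ℕ)
    {g : ℝ → ℝ≥0∞} (hg : Measurable g) :
    Measurable fun y => ∫⁻ t, g t ∂(coordPosterior μ n y) := by
  simp_rw [coordPosterior, lintegral_tilted]
  have h1 : Measurable fun y : ℝ => ∫ t, Real.exp (-((n : ℝ) / 2) * (y - t) ^ 2) ∂μ :=
    (StronglyMeasurable.integral_prod_right'
      (f := fun p : ℝ × ℝ => Real.exp (-((n : ℝ) / 2) * (p.1 - p.2) ^ 2))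
      (by fun_prop)).measurable
  refine Measurable.lintegral_prod_right' (f := fun p : ℝ × ℝ =>
    ENNReal.ofReal (Real.exp (-((n : ℝ) / 2) * (p.1 - p.2) ^ 2) /
      ∫ t, Real.exp (-((n : ℝ) / 2) * (p.1 - t) ^ 2) ∂μ) * g p.2) ?_
  refine Measurable.mul (ENNReal.measurable_ofReal.comp (Measurable.div (by fun_prop) ?_))
    (hg.comp measurable_snd)
  exact h1.comp measurable_fst

theorem lintegral_infinitePi_prod (μ : ℕ → Measure ℝ) [∀ k, IsProbabilityMeasure (μ k)]
    (s : Finset ℕ) {g : ℕ → ℝ → ℝ≥0∞} (hg : ∀ k, Measurable (g k)) :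
    ∫⁻ f, ∏ k ∈ s, g k (f k) ∂(Measure.infinitePi μ) = ∏ k ∈ s, ∫⁻ t, g k t ∂(μ k) := by
  rw [lintegral_prod_eq_prod_lintegral_of_indepFun s (fun k (f : ℕ → ℝ) => g k (f k))
    (iIndepFun_infinitePi hg) fun k => (hg k).comp (measurable_pi_apply k)]
  exact Finset.prod_congr rfl fun k _ =>
    (measurePreserving_eval_infinitePi μ k).lintegral_comp (hg k)

theorem lintegral_infinitePi_eval (μ : ℕ → Measure ℝ) [∀ k, IsProbabilityMeasure (μ k)]
    (k : ℕ) {g : ℝ → ℝ≥0∞} (hg : Measurable g) :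
    ∫⁻ f, g (f k) ∂(Measure.infinitePi μ) = ∫⁻ t, g t ∂(μ k) :=
  (measurePreserving_eval_infinitePi μ k).lintegral_comp hg

/-! ### One coordinate: posterior mass away from the truth. -/

theorem le_densityLaw_Icc {h : ℝ → ℝ} (hh : IsHeavyTailed h) {a b : ℝ} (ha : 0 < a)
    (hab : a ≤ b) :
    ENNReal.ofReal ((b - a) * h b) ≤ densityLaw h (Set.Icc a b) := by
  rw [densityLaw, withDensity_apply _ measurableSet_Icc, mul_comm,
    ENNReal.ofReal_mul (hh.pos b (by linarith)).le, ← Real.volume_Icc, ← setLIntegral_const]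
  refine setLIntegral_mono' measurableSet_Icc fun x hx => ENNReal.ofReal_le_ofReal ?_
  exact hh.anti (Set.mem_Ioi.2 (ha.trans_le hx.1)) (Set.mem_Ioi.2 (ha.trans_le hab)) hx.2

/-- The likelihood carries no Gaussian constant, so the normalizer in Bayes' formula is at most 1
and can be dropped from a lower bound. -/
theorem mul_le_coordPosterior (μ : Measure ℝ) [IsProbabilityMeasure μ] (n : ℕ) (y r : ℝ)
    {S T : Set ℝ} (hS : MeasurableSet S) (hT : MeasurableSet T) (hTS : T ⊆ S)
    (hr : ∀ t ∈ T, (n : ℝ) * (y - t) ^ 2 ≤ r) :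
    ENNReal.ofReal (Real.exp (-(r / 2))) * μ T ≤ coordPosterior μ n y S := by
  rw [coordPosterior_apply μ n y hS]
  have hden : ∫⁻ t, ENNReal.ofReal (Real.exp (-((n : ℝ) / 2) * (y - t) ^ 2)) ∂μ ≤ 1 := by
    calc _ ≤ ∫⁻ _, 1 ∂μ := lintegral_mono fun t => by
          rw [ENNReal.ofReal_le_one, Real.exp_le_one_iff]
          have : 0 ≤ ((n : ℝ) / 2) * (y - t) ^ 2 := by positivity
          linarith
      _ = 1 := by simp
  refine le_trans ?_ (ENNReal.div_le_div_left hden _)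
  rw [div_one, ← setLIntegral_const]
  refine (setLIntegral_mono' hT fun t ht => ENNReal.ofReal_le_ofReal
    (Real.exp_le_exp.2 ?_)).trans (lintegral_mono_set hTS)
  linarith [hr t ht]

/-- With `y = θ + z / √n`, the bounds `|√n θ| < 1` and `|z| ≤ 1` give `|√n y| ≤ 2`. -/
theorem gaussianReal_Icc_le {n : ℕ} (hn : n ≠ 0) {θ : ℝ} (hθ : (n : ℝ) * θ ^ 2 < 1) :
    gaussianReal 0 1 (Set.Icc (-1) 1) ≤
      gaussianReal θ ((n : ℝ≥0)⁻¹) {y | (n : ℝ) * y ^ 2 ≤ 4} := by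
  have hn0 : (0 : ℝ) < n := by positivity
  have hmap : gaussianReal θ ((n : ℝ≥0)⁻¹) =
      (gaussianReal 0 1).map fun z => θ + (√(n : ℝ))⁻¹ * z := by
    have h1 : (gaussianReal 0 1).map (fun z => (√(n : ℝ))⁻¹ * z) =
        gaussianReal 0 ((n : ℝ≥0)⁻¹) := by
      rw [gaussianReal_map_const_mul, mul_zero]
      congr 1
      ext
      simp [inv_pow, Real.sq_sqrt hn0.le]
    rw [← zero_add θ, ← gaussianReal_map_const_add θ, ← h1, Measure.map_map (by fun_prop) (by fun_prop)]
    simp [Function.comp_def]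
  have hms : MeasurableSet {y : ℝ | (n : ℝ) * y ^ 2 ≤ 4} :=
    measurableSet_le (by fun_prop) measurable_const
  rw [hmap, Measure.map_apply (by fun_prop) hms]
  refine measure_mono fun z hz => ?_
  have hs : (0 : ℝ) < √n := Real.sqrt_pos.2 hn0
  have hsq : √(n : ℝ) ^ 2 = n := Real.sq_sqrt hn0.le
  have h1 : |√(n : ℝ) * θ| < 1 := by
    rw [← sq_lt_one_iff_abs_lt_one, mul_pow, hsq]; exact hθ
  have h2 : √(n : ℝ) * (θ + (√(n : ℝ))⁻¹ * z) = √n * θ + z := by field_simp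
  have h3 : (n : ℝ) * (θ + (√(n : ℝ))⁻¹ * z) ^ 2 = (√n * θ + z) ^ 2 := by
    rw [← h2, mul_pow, hsq]
  change (n : ℝ) * (θ + (√(n : ℝ))⁻¹ * z) ^ 2 ≤ 4
  rw [h3]
  obtain ⟨h4, h5⟩ := abs_lt.1 h1
  nlinarith [hz.1, hz.2]

theorem exists_le_lintegral_coordPosterior {h : ℝ → ℝ} (hh : IsHeavyTailed h) {A : ℝ}
    (hA : 0 < A) : ∃ c : ℝ, 0 < c ∧ ∀ n : ℕ, n ≠ 0 → ∀ s : ℝ, A ≤ √(n : ℝ) * s →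
      √(n : ℝ) * s ≤ 1 → ∀ θ : ℝ, ENNReal.ofReal (c * (1 - n * θ ^ 2)) ≤
        ∫⁻ y, coordPosterior ((densityLaw h).map (s * ·)) n y {t | 1 ≤ (n : ℝ) * (t - θ) ^ 2}
          ∂(gaussianReal θ ((n : ℝ≥0)⁻¹)) := by
  have := hh.isProbabilityMeasure
  set γ := (gaussianReal 0 1).real (Set.Icc (-1) 1) with hγ
  have hγ0 : 0 < γ := by
    refine ENNReal.toReal_pos (fun h0 => ?_) (measure_ne_top _ _)
    have := gaussianReal_absolutelyContinuous' 0 one_ne_zero h0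
    norm_num [Real.volume_Icc] at this
  have hhA : 0 < h (4 / A) := hh.pos _ (by positivity)
  -- The factors bound from below the likelihood on `T`, the prior mass of `T`, and the probability
  -- of `|√n y| ≤ 2`.
  refine ⟨Real.exp (-(36 / 2)) * (2 * h (4 / A)) * γ, by positivity, ?_⟩
  intro n hn s hs1 hs2 θ
  have hn0 : (0 : ℝ) < n := by positivity
  have hw : (0 : ℝ) < √n := Real.sqrt_pos.2 hn0
  have hwsq : √(n : ℝ) ^ 2 = n := Real.sq_sqrt hn0.le
  have hs0 : 0 < s := pos_of_mul_pos_right (hA.trans_le hs1) hw.le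
  rcases le_or_gt 1 ((n : ℝ) * θ ^ 2) with hθ | hθ
  · rw [ENNReal.ofReal_of_nonpos (mul_nonpos_of_nonneg_of_nonpos (by positivity) (by linarith))]
    exact zero_le
  have hθ1 : |√(n : ℝ) * θ| < 1 := by
    rw [← sq_lt_one_iff_abs_lt_one, mul_pow, hwsq]; exact hθ
  obtain ⟨hθ2, hθ3⟩ := abs_lt.1 hθ1
  set μ := (densityLaw h).map (s * ·) with hμ
  have : IsProbabilityMeasure μ :=
    Measure.isProbabilityMeasure_map (measurable_const_mul _).aemeasurable
  set r := √(n : ℝ) * s with hr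
  have hr0 : 0 < r := by positivity
  -- Since `|√n θ| < 1`, every point of `T` is at distance at least `1 / √n` from `θ`.
  set T := Set.Icc (2 / √(n : ℝ)) (4 / √n) with hT
  have hprior : ENNReal.ofReal (2 * h (4 / A)) ≤ μ T := by
    rw [hμ, Measure.map_apply (measurable_const_mul _) measurableSet_Icc]
    -- In the variable `ζ = t / s` the interval is `[2 / r, 4 / r]`: `r ≤ 1` makes its length at
    -- least 2, and `r ≥ A` keeps it to the left of `4 / A`, where `h` is at least `h (4 / A)`.
    refine le_trans ?_ ((le_densityLaw_Icc hh (a := 2 / r) (b := 4 / r) (by positivity)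
      (by gcongr; norm_num)).trans
      (measure_mono fun z hz => ?_))
    · refine ENNReal.ofReal_le_ofReal ?_
      have h1 : h (4 / A) ≤ h (4 / r) :=
        hh.anti (Set.mem_Ioi.2 (by positivity)) (Set.mem_Ioi.2 (by positivity)) (by gcongr)
      have h2 : 2 ≤ 4 / r - 2 / r := by
        rw [← sub_div, le_div_iff₀ hr0]; linarith
      exact mul_le_mul h2 h1 hhA.le (by linarith)
    · obtain ⟨h1, h2⟩ := hz
      rw [div_le_iff₀ hr0, hr] at h1
      rw [le_div_iff₀ hr0, hr] at h2
      constructor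
      · rw [div_le_iff₀ hw]; linarith
      · rw [le_div_iff₀ hw]; linarith
  have hTbd : ∀ t ∈ T, 2 ≤ √(n : ℝ) * t ∧ √(n : ℝ) * t ≤ 4 := fun t ht => by
    obtain ⟨h1, h2⟩ := ht
    rw [div_le_iff₀ hw] at h1
    rw [le_div_iff₀ hw] at h2
    constructor <;> linarith
  have hSm : MeasurableSet {t : ℝ | 1 ≤ (n : ℝ) * (t - θ) ^ 2} :=
    measurableSet_le measurable_const (by fun_prop)
  have hYm : MeasurableSet {y : ℝ | (n : ℝ) * y ^ 2 ≤ 4} :=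
    measurableSet_le (by fun_prop) measurable_const
  have hTS : T ⊆ {t : ℝ | 1 ≤ (n : ℝ) * (t - θ) ^ 2} := fun t ht => by
    obtain ⟨h1, h2⟩ := hTbd t ht
    have : (n : ℝ) * (t - θ) ^ 2 = (√n * t - √n * θ) ^ 2 := by rw [← mul_sub, mul_pow, hwsq]
    rw [Set.mem_ofPred_eq, this]
    nlinarith
  calc ENNReal.ofReal (Real.exp (-(36 / 2)) * (2 * h (4 / A)) * γ * (1 - n * θ ^ 2))
      ≤ ENNReal.ofReal (Real.exp (-(36 / 2)) * (2 * h (4 / A)) * γ) := by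
        refine ENNReal.ofReal_le_ofReal (mul_le_of_le_one_right (by positivity) ?_)
        have : 0 ≤ (n : ℝ) * θ ^ 2 := by positivity
        linarith
    _ = ENNReal.ofReal (Real.exp (-(36 / 2))) * ENNReal.ofReal (2 * h (4 / A)) *
          gaussianReal 0 1 (Set.Icc (-1) 1) := by
        rw [ENNReal.ofReal_mul (by positivity), ENNReal.ofReal_mul (by positivity), hγ,
          ofReal_measureReal]
    _ ≤ ENNReal.ofReal (Real.exp (-(36 / 2))) * μ T *
          gaussianReal θ ((n : ℝ≥0)⁻¹) {y | (n : ℝ) * y ^ 2 ≤ 4} := by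
        exact mul_le_mul' (mul_le_mul_right hprior _) (gaussianReal_Icc_le hn hθ)
    _ ≤ ∫⁻ y in {y | (n : ℝ) * y ^ 2 ≤ 4}, coordPosterior μ n y
          {t | 1 ≤ (n : ℝ) * (t - θ) ^ 2} ∂(gaussianReal θ ((n : ℝ≥0)⁻¹)) := by
        rw [← setLIntegral_const]
        refine setLIntegral_mono' hYm fun y hy =>
          -- `36 = (2 + 4)²`, from `|√n y| ≤ 2` and `√n t ≤ 4`.
          mul_le_coordPosterior μ n y 36 hSm measurableSet_Icc hTS fun t ht => ?_
        obtain ⟨h1, h2⟩ := hTbd t ht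
        have h3 : (√(n : ℝ) * y) ^ 2 ≤ 2 ^ 2 := by
          rw [mul_pow, hwsq]; norm_num; exact hy
        obtain ⟨h4, h5⟩ := abs_le.1 (abs_le_of_sq_le_sq h3 (by norm_num))
        have : (n : ℝ) * (y - t) ^ 2 = (√n * y - √n * t) ^ 2 := by rw [← mul_sub, mul_pow, hwsq]
        rw [this]
        nlinarith
    _ ≤ _ := setLIntegral_le_lintegral _ _

/-! ### The block of critical frequencies. -/

/-- The frequency `n ^ (1 / (2 α + 1))` up to which the prior dominates the noise. -/
noncomputable def cutoff (α : ℝ) (n : ℕ) : ℝ := (n : ℝ) ^ (1 / (2 * α + 1))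

/-- The indices of the frequencies of the order of `cutoff α n`. -/
noncomputable def block (α : ℝ) (n : ℕ) : Finset ℕ :=
  Finset.Ico ⌈cutoff α n⌉₊ (2 * ⌈cutoff α n⌉₊)

theorem one_le_cutoff {α : ℝ} (hα : 0 < α) {n : ℕ} (hn : n ≠ 0) : 1 ≤ cutoff α n :=
  Real.one_le_rpow (by exact_mod_cast Nat.one_le_iff_ne_zero.2 hn) (by positivity)

theorem cutoff_rpow (α : ℝ) (n : ℕ) (b : ℝ) :
    cutoff α n ^ b = (n : ℝ) ^ (b / (2 * α + 1)) := by
  rw [cutoff, ← Real.rpow_mul (Nat.cast_nonneg n)]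
  congr 1
  ring

theorem tendsto_cutoff {α : ℝ} (hα : 0 < α) : Tendsto (cutoff α) atTop atTop :=
  (tendsto_rpow_atTop (by positivity)).comp tendsto_natCast_atTop_atTop

theorem cutoff_le_of_mem_block {α : ℝ} {n k : ℕ} (hk : k ∈ block α n) :
    cutoff α n ≤ (k : ℝ) + 1 := by
  have h1 := Nat.ceil_le.1 (Finset.mem_Ico.1 hk).1
  linarith

/-- Rounding up costs at most 1, which `1 ≤ cutoff α n` absorbs: `k + 1 ≤ 2⌈N⌉ ≤ 2N + 2 ≤ 4N`. -/
theorem le_cutoff_of_mem_block {α : ℝ} (hα : 0 < α) {n k : ℕ} (hn : n ≠ 0)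
    (hk : k ∈ block α n) : (k : ℝ) + 1 ≤ 4 * cutoff α n := by
  have h1 : (k : ℝ) + 1 ≤ 2 * (⌈cutoff α n⌉₊ : ℝ) := by
    exact_mod_cast (Finset.mem_Ico.1 hk).2
  have h2 := one_le_cutoff hα hn
  have h3 := Nat.ceil_lt_add_one (zero_le_one.trans h2)
  linarith

theorem cutoff_le_card_block (α : ℝ) (n : ℕ) : cutoff α n ≤ ((block α n).card : ℝ) := by
  have : (block α n).card = ⌈cutoff α n⌉₊ := by simp [block, two_mul]
  rw [this]
  exact Nat.le_ceil _

/-- This is what singles out the cutoff: `√n = N ^ (1/2 + α)`. -/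
theorem sqrt_mul_scaling {α : ℝ} (hα : 0 < α) (n k : ℕ) :
    √(n : ℝ) * scaling α k = (cutoff α n / ((k : ℝ) + 1)) ^ (1 / 2 + α) := by
  have h0 : 0 ≤ cutoff α n := Real.rpow_nonneg (Nat.cast_nonneg n) _
  have h2 : -(1 / 2) - α = -(1 / 2 + α) := by ring
  rw [Real.div_rpow h0 (by positivity), cutoff_rpow, scaling, h2, Real.rpow_neg (by positivity),
    div_eq_mul_inv, Real.sqrt_eq_rpow]
  congr 2
  field_simp
  ring

theorem sqrt_mul_scaling_le_one {α : ℝ} (hα : 0 < α) {n k : ℕ} (hk : k ∈ block α n) :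
    √(n : ℝ) * scaling α k ≤ 1 := by
  have h0 : 0 ≤ cutoff α n := Real.rpow_nonneg (Nat.cast_nonneg n) _
  rw [sqrt_mul_scaling hα]
  refine Real.rpow_le_one (by positivity) ?_ (by positivity)
  rw [div_le_one (by positivity)]
  exact cutoff_le_of_mem_block hk

theorem le_sqrt_mul_scaling {α : ℝ} (hα : 0 < α) {n k : ℕ} (hn : n ≠ 0) (hk : k ∈ block α n) :
    (1 / 4 : ℝ) ^ (1 / 2 + α) ≤ √(n : ℝ) * scaling α k := by
  rw [sqrt_mul_scaling hα]
  refine Real.rpow_le_rpow (by norm_num) ?_ (by positivity)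
  rw [le_div_iff₀ (by positivity)]
  linarith [le_cutoff_of_mem_block hα hn hk]

/-- The Sobolev bound gives `n ∑ f₀ₖ² ≤ F² N ^ (2α + 1 - 2β)`, which is `N` times a null sequence
because `α < β`, while the block has at least `N` elements. -/
theorem eventually_le_sum_block {α β F : ℝ} (hα : 0 < α) (hαβ : α < β) {f₀ : ℕ → ℝ}
    (hf₀ : f₀ ∈ sobolevBall β F) : ∀ᶠ n : ℕ in atTop,
      cutoff α n / 2 ≤ ∑ k ∈ block α n, (1 - n * f₀ k ^ 2) := by
  have hlim : Tendsto (fun n => F ^ 2 * cutoff α n ^ (-(2 * (β - α)))) atTop (𝓝 (F ^ 2 * 0)) :=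
    ((tendsto_rpow_neg_atTop (by linarith)).comp (tendsto_cutoff hα)).const_mul _
  rw [mul_zero] at hlim
  filter_upwards [hlim.eventually_le_const (show (0 : ℝ) < 1 / 2 by norm_num),
    eventually_ne_atTop 0] with n hn hn0
  have hN : 0 < cutoff α n := zero_lt_one.trans_le (one_le_cutoff hα hn0)
  have h1 := sum_sq_le_of_mem_sobolevBall (by linarith) hN hf₀
    fun k hk => cutoff_le_of_mem_block (α := α) (n := n) hk
  have h2 : (n : ℝ) = cutoff α n ^ (2 * α + 1) := by
    rw [cutoff_rpow, div_self (by positivity), Real.rpow_one]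
  have h3 : (n : ℝ) * (F ^ 2 * cutoff α n ^ (-(2 * β))) =
      F ^ 2 * cutoff α n ^ (-(2 * (β - α))) * cutoff α n := by
    have : cutoff α n ^ (2 * α + 1) * cutoff α n ^ (-(2 * β)) =
        cutoff α n ^ (-(2 * (β - α))) * cutoff α n := by
      rw [← Real.rpow_add hN, ← Real.rpow_add_one hN.ne']
      congr 1
      ring
    calc _ = F ^ 2 * (cutoff α n ^ (2 * α + 1) * cutoff α n ^ (-(2 * β))) := by
          rw [← h2]; ring
      _ = _ := by rw [this]; ring
  have h4 : (n : ℝ) * ∑ k ∈ block α n, f₀ k ^ 2 ≤ 1 / 2 * cutoff α n :=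
    calc _ ≤ (n : ℝ) * (F ^ 2 * cutoff α n ^ (-(2 * β))) := by gcongr
      _ ≤ _ := by rw [h3]; gcongr
  rw [Finset.sum_sub_distrib, ← Finset.mul_sum]
  have h5 := cutoff_le_card_block α n
  simp only [Finset.sum_const, nsmul_eq_mul, mul_one]
  linarith

/-! ### From single coordinates to the posterior on sequences. -/

/-- Integrates the pointwise bound `exp (-u) + (1 - exp (-1)) 1{u ≥ 1} ≤ 1`, `u ≥ 0`. -/
theorem lintegral_exp_neg_le (ν : Measure ℝ) [IsProbabilityMeasure ν] (n : ℕ) (θ : ℝ) :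
    ∫⁻ t, ENNReal.ofReal (Real.exp (-(n * (t - θ) ^ 2))) ∂ν +
      ENNReal.ofReal (1 - Real.exp (-1)) * ν {t | 1 ≤ (n : ℝ) * (t - θ) ^ 2} ≤ 1 := by
  have hS : MeasurableSet {t : ℝ | 1 ≤ (n : ℝ) * (t - θ) ^ 2} :=
    measurableSet_le measurable_const (by fun_prop)
  rw [← lintegral_indicator_const hS, ← lintegral_add_left (by fun_prop)]
  calc _ ≤ ∫⁻ _, 1 ∂ν := lintegral_mono fun t => ?_
    _ = 1 := by simp
  have he : 0 ≤ 1 - Real.exp (-1) := by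
    have := Real.exp_le_one_iff.2 (show (-1 : ℝ) ≤ 0 by norm_num)
    linarith
  by_cases ht : 1 ≤ (n : ℝ) * (t - θ) ^ 2
  · rw [Set.indicator_of_mem (by exact ht), ← ENNReal.ofReal_add (Real.exp_pos _).le he,
      ENNReal.ofReal_le_one]
    have : Real.exp (-(n * (t - θ) ^ 2)) ≤ Real.exp (-1) := Real.exp_le_exp.2 (by linarith)
    linarith
  · rw [Set.indicator_of_notMem (by exact ht), add_zero, ENNReal.ofReal_le_one,
      Real.exp_le_one_iff]
    have : 0 ≤ (n : ℝ) * (t - θ) ^ 2 := by positivity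
    linarith

/-- Follows from `1 - u ≤ exp (-u)`. The exponential form turns the product over coordinates into a
sum in the exponent. -/
theorem lintegral_coordPosterior_exp_le (μ : Measure ℝ) [IsProbabilityMeasure μ] (n : ℕ)
    (θ x : ℝ) (γ : Measure ℝ) [IsProbabilityMeasure γ]
    (hx : ENNReal.ofReal x ≤
      ∫⁻ y, coordPosterior μ n y {t | 1 ≤ (n : ℝ) * (t - θ) ^ 2} ∂γ) :
    ∫⁻ y, (∫⁻ t, ENNReal.ofReal (Real.exp (-(n * (t - θ) ^ 2))) ∂(coordPosterior μ n y)) ∂γ ≤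
      ENNReal.ofReal (Real.exp (-((1 - Real.exp (-1)) * x))) := by
  have he : 0 ≤ 1 - Real.exp (-1) := by
    have := Real.exp_le_one_iff.2 (show (-1 : ℝ) ≤ 0 by norm_num)
    linarith
  have h1 := lintegral_mono (μ := γ) fun y => lintegral_exp_neg_le (coordPosterior μ n y) n θ
  rw [lintegral_add_left (measurable_lintegral_coordPosterior μ n (by fun_prop)),
    lintegral_const_mul' _ _ ENNReal.ofReal_ne_top, lintegral_const, measure_univ, mul_one] at h1
  have h2 := (add_le_add_right (mul_le_mul_right hx (ENNReal.ofReal (1 - Real.exp (-1)))) _).trans h1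
  rw [← ENNReal.ofReal_mul he] at h2
  refine (ENNReal.le_sub_of_add_le_right ENNReal.ofReal_ne_top h2).trans ?_
  rw [tsub_le_iff_right]
  -- For `x < 0`, which occurs when `n θ² > 1`, the right-hand side is at least 1 and the bound is
  -- trivial.
  rcases le_total 0 ((1 - Real.exp (-1)) * x) with hx0 | hx0
  · rw [← ENNReal.ofReal_add (Real.exp_pos _).le hx0, ENNReal.one_le_ofReal]
    linarith [Real.add_one_le_exp (-((1 - Real.exp (-1)) * x))]
  · rw [ENNReal.ofReal_of_nonpos hx0, add_zero, ENNReal.one_le_ofReal, Real.one_le_exp_iff]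
    linarith

theorem posterior_htPrior_eq {h : ℝ → ℝ} (hh : IsHeavyTailed h) (α : ℝ) (n : ℕ) (x : ℕ → ℝ) :
    posterior (htPrior h α) n x = Measure.infinitePi fun k =>
      coordPosterior ((densityLaw h).map (scaling α k * ·)) n (x k) :=
  (posterior_htPrior hh α n x).2

theorem isProbabilityMeasure_map_scaling {h : ℝ → ℝ} (hh : IsHeavyTailed h) (α : ℝ) (k : ℕ) :
    IsProbabilityMeasure ((densityLaw h).map (scaling α k * ·)) :=
  have := hh.isProbabilityMeasure
  Measure.isProbabilityMeasure_map (measurable_const_mul _).aemeasurable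

/-- An exponential Markov bound for the posterior mass of an `ℓ²` ball: the exponential moment of
the squared distance restricted to finitely many coordinates is a product over the coordinates. -/
theorem lintegral_posterior_ball_le {h : ℝ → ℝ} (hh : IsHeavyTailed h) (α : ℝ) (n : ℕ)
    (f₀ : ℕ → ℝ) {r : ℝ} (hr : 0 ≤ r) (s : Finset ℕ) :
    ∫⁻ x, posterior (htPrior h α) n x {f | l2norm (f - f₀) ≤ ENNReal.ofReal r} ∂(dataLaw n f₀) ≤
      ENNReal.ofReal (Real.exp (n * r ^ 2)) *
        ∏ k ∈ s, ∫⁻ y, (∫⁻ t, ENNReal.ofReal (Real.exp (-(n * (t - f₀ k) ^ 2)))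
          ∂(coordPosterior ((densityLaw h).map (scaling α k * ·)) n y))
          ∂(gaussianReal (f₀ k) ((n : ℝ≥0)⁻¹)) := by
  have := isProbabilityMeasure_map_scaling hh α
  have hm (k : ℕ) : Measurable fun t : ℝ => ENNReal.ofReal (Real.exp (-(n * (t - f₀ k) ^ 2))) := by
    fun_prop
  -- Folding the product back into an integral over the data law allows a comparison pointwise in
  -- `x`, with no measurability of the posterior mass of the ball in `x`.
  rw [← lintegral_infinitePi_prod (fun k => gaussianReal (f₀ k) ((n : ℝ≥0)⁻¹)) s
      fun k => measurable_lintegral_coordPosterior _ n (hm k),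
    ← lintegral_const_mul' _ _ ENNReal.ofReal_ne_top]
  refine lintegral_mono fun x => ?_
  rw [posterior_htPrior_eq hh]
  dsimp only
  rw [← lintegral_infinitePi_prod
    (fun k => coordPosterior ((densityLaw h).map (scaling α k * ·)) n (x k)) s hm]
  have hsub : {f : ℕ → ℝ | l2norm (f - f₀) ≤ ENNReal.ofReal r} ⊆
      {f | ENNReal.ofReal (Real.exp (-(n * r ^ 2))) ≤
        ∏ k ∈ s, ENNReal.ofReal (Real.exp (-(n * (f k - f₀ k) ^ 2)))} := fun f hf => by
    have h1 := sum_sq_le_of_l2norm_le hr hf s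
    simp only [Pi.sub_apply] at h1
    rw [Set.mem_ofPred_eq, ← ENNReal.ofReal_prod_of_nonneg fun _ _ => (Real.exp_pos _).le,
      ← Real.exp_sum, Finset.sum_neg_distrib, ← Finset.mul_sum]
    gcongr
  have hmark := mul_meas_ge_le_lintegral
    (μ := Measure.infinitePi fun k =>
      coordPosterior ((densityLaw h).map (scaling α k * ·)) n (x k))
    (Finset.measurable_prod s fun k _ => (hm k).comp (measurable_pi_apply k))
    (ENNReal.ofReal (Real.exp (-(n * r ^ 2))))
  refine (measure_mono hsub).trans ?_
  refine le_trans ?_ (mul_le_mul_right hmark _)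
  rw [← mul_assoc, ← ENNReal.ofReal_mul (Real.exp_pos _).le, ← Real.exp_add, add_neg_cancel,
    Real.exp_zero, ENNReal.ofReal_one, one_mul]
  rfl

/-- Uses `(t - θ)² ≥ n⁻¹ 1{n (t - θ)² ≥ 1}` in each coordinate of `s`; the other coordinates are
discarded. -/
theorem sum_le_lintegral_posterior_risk {h : ℝ → ℝ} (hh : IsHeavyTailed h) (α : ℝ) {n : ℕ}
    (hn : n ≠ 0) (f₀ : ℕ → ℝ) (s : Finset ℕ) :
    ENNReal.ofReal (n : ℝ)⁻¹ * ∑ k ∈ s, ∫⁻ y,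
        coordPosterior ((densityLaw h).map (scaling α k * ·)) n y
          {t | 1 ≤ (n : ℝ) * (t - f₀ k) ^ 2} ∂(gaussianReal (f₀ k) ((n : ℝ≥0)⁻¹)) ≤
      ∫⁻ x, (∫⁻ f, l2norm (f - f₀) ^ 2 ∂(posterior (htPrior h α) n x)) ∂(dataLaw n f₀) := by
  have := isProbabilityMeasure_map_scaling hh α
  have hn0 : (0 : ℝ) < n := by positivity
  have hS (k : ℕ) : MeasurableSet {t : ℝ | 1 ≤ (n : ℝ) * (t - f₀ k) ^ 2} :=
    measurableSet_le measurable_const (by fun_prop)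
  have hm (k : ℕ) : Measurable fun y =>
      coordPosterior ((densityLaw h).map (scaling α k * ·)) n y
        {t | 1 ≤ (n : ℝ) * (t - f₀ k) ^ 2} := by
    simp_rw [← lintegral_indicator_one (hS k)]
    exact measurable_lintegral_coordPosterior _ n (measurable_one.indicator (hS k))
  have hx (k : ℕ) : Measurable fun x : ℕ → ℝ =>
      coordPosterior ((densityLaw h).map (scaling α k * ·)) n (x k)
        {t | 1 ≤ (n : ℝ) * (t - f₀ k) ^ 2} := (hm k).comp (measurable_pi_apply k)
  have hf (k : ℕ) : Measurable fun f : ℕ → ℝ =>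
      {t : ℝ | 1 ≤ (n : ℝ) * (t - f₀ k) ^ 2}.indicator (1 : ℝ → ℝ≥0∞) (f k) :=
    (measurable_one.indicator (hS k)).comp (measurable_pi_apply k)
  simp_rw [← lintegral_infinitePi_eval (fun k => gaussianReal (f₀ k) ((n : ℝ≥0)⁻¹)) _ (hm _)]
  rw [← lintegral_finsetSum _ fun k _ => hx k,
    ← lintegral_const_mul' _ _ ENNReal.ofReal_ne_top]
  refine lintegral_mono fun x => ?_
  rw [posterior_htPrior_eq hh]
  set P := Measure.infinitePi fun k =>
    coordPosterior ((densityLaw h).map (scaling α k * ·)) n (x k) with hP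
  have hk (k : ℕ) : coordPosterior ((densityLaw h).map (scaling α k * ·)) n (x k)
      {t | 1 ≤ (n : ℝ) * (t - f₀ k) ^ 2} =
      ∫⁻ f, {t : ℝ | 1 ≤ (n : ℝ) * (t - f₀ k) ^ 2}.indicator 1 (f k) ∂P := by
    rw [hP, lintegral_infinitePi_eval _ k (measurable_one.indicator (hS k)),
      lintegral_indicator_one (hS k)]
  simp_rw [hk]
  rw [← lintegral_finsetSum _ fun k _ => hf k,
    ← lintegral_const_mul' _ _ ENNReal.ofReal_ne_top]
  refine lintegral_mono fun f => ?_
  dsimp only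
  rw [l2norm_sq, Finset.mul_sum]
  refine le_trans (Finset.sum_le_sum fun k _ => ?_) (ENNReal.sum_le_tsum s)
  by_cases ht : 1 ≤ (n : ℝ) * (f k - f₀ k) ^ 2
  · rw [Set.indicator_of_mem (by exact ht), Pi.one_apply, mul_one]
    refine ENNReal.ofReal_le_ofReal ?_
    rw [inv_le_iff_one_le_mul₀ hn0, mul_comm]
    exact ht
  · rw [Set.indicator_of_notMem (by exact ht), mul_zero]
    exact zero_le

/-! ### The two lower bounds for the rate. -/

theorem exists_le_lintegral_coordPosterior_block {h : ℝ → ℝ} (hh : IsHeavyTailed h) {α : ℝ}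
    (hα : 0 < α) : ∃ c : ℝ, 0 < c ∧ ∀ n : ℕ, n ≠ 0 → ∀ k ∈ block α n, ∀ θ : ℝ,
      ENNReal.ofReal (c * (1 - n * θ ^ 2)) ≤
        ∫⁻ y, coordPosterior ((densityLaw h).map (scaling α k * ·)) n y
          {t | 1 ≤ (n : ℝ) * (t - θ) ^ 2} ∂(gaussianReal θ ((n : ℝ≥0)⁻¹)) := by
  obtain ⟨c, hc, H⟩ := exists_le_lintegral_coordPosterior hh
    (A := (1 / 4 : ℝ) ^ (1 / 2 + α)) (by positivity)
  exact ⟨c, hc, fun n hn k hk θ => H n hn _ (le_sqrt_mul_scaling hα hn hk)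
    (sqrt_mul_scaling_le_one hα hk) θ⟩

theorem tendsto_lintegral_posterior_ball {h : ℝ → ℝ} (hh : IsHeavyTailed h) {α β F : ℝ}
    (hα : 0 < α) (hαβ : α < β) {f₀ : ℕ → ℝ} (hf₀ : f₀ ∈ sobolevBall β F) {δ : ℝ} (hδ : 0 < δ) :
    Tendsto (fun n : ℕ => ∫⁻ x, posterior (htPrior h α) n x
      {f | l2norm (f - f₀) ≤
        ENNReal.ofReal ((n : ℝ) ^ (-(α / (2 * α + 1))) * Real.log n ^ (-δ))}
      ∂(dataLaw n f₀)) atTop (𝓝 0) := by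
  obtain ⟨c, hc, H⟩ := exists_le_lintegral_coordPosterior_block hh hα
  have he : 0 < 1 - Real.exp (-1) := by
    have := Real.exp_lt_one_iff.2 (show (-1 : ℝ) < 0 by norm_num)
    linarith
  set d := (1 - Real.exp (-1)) * c with hd
  have hd0 : 0 < d := by positivity
  have hlog : Tendsto (fun n : ℕ => Real.log n ^ (-δ)) atTop (𝓝 0) :=
    (tendsto_rpow_neg_atTop hδ).comp (Real.tendsto_log_atTop.comp tendsto_natCast_atTop_atTop)
  have hlog2 : Tendsto (fun n : ℕ => (Real.log n ^ (-δ)) ^ 2) atTop (𝓝 0) := by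
    simpa using hlog.pow 2
  have hlim : Tendsto (fun n => ENNReal.ofReal (Real.exp (-(d / 4 * cutoff α n)))) atTop (𝓝 0) := by
    rw [← ENNReal.ofReal_zero]
    exact ENNReal.tendsto_ofReal (Real.tendsto_exp_neg_atTop_nhds_zero.comp
      ((tendsto_cutoff hα).const_mul_atTop (by positivity)))
  refine tendsto_of_tendsto_of_tendsto_of_le_of_le' tendsto_const_nhds hlim
    (.of_forall fun _ => zero_le) ?_
  filter_upwards [eventually_le_sum_block hα hαβ hf₀, eventually_ne_atTop 0,
    -- Half of the exponent `d N / 2` is spent on `n φₙ²`, which leaves `exp (-d N / 4)`.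
    hlog2.eventually_le_const (show 0 < d / 4 by positivity)] with n hn hn0 hnl
  have hN : 0 < cutoff α n := zero_lt_one.trans_le (one_le_cutoff hα hn0)
  have hlogn : 0 ≤ Real.log n := Real.log_natCast_nonneg n
  refine (lintegral_posterior_ball_le hh α n f₀ (by positivity) (block α n)).trans ?_
  have := isProbabilityMeasure_map_scaling hh α
  have hprod := Finset.prod_le_prod' fun k (hk : k ∈ block α n) =>
    lintegral_coordPosterior_exp_le ((densityLaw h).map (scaling α k * ·)) n (f₀ k) _ _
      (H n hn0 k hk (f₀ k))
  refine (mul_le_mul_right hprod _).trans ?_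
  rw [← ENNReal.ofReal_prod_of_nonneg fun _ _ => (Real.exp_pos _).le, ← Real.exp_sum,
    ← ENNReal.ofReal_mul (Real.exp_pos _).le, ← Real.exp_add]
  refine ENNReal.ofReal_le_ofReal (Real.exp_le_exp.2 ?_)
  have h1 : (n : ℝ) * ((n : ℝ) ^ (-(α / (2 * α + 1))) * Real.log n ^ (-δ)) ^ 2 =
      cutoff α n * (Real.log n ^ (-δ)) ^ 2 := by
    rw [mul_pow, ← mul_assoc]
    congr 1
    have hn1 : (0 : ℝ) < n := by positivity
    rw [← Real.rpow_natCast, ← Real.rpow_mul hn1.le, ← Real.rpow_one_add' hn1.le, cutoff]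
    · congr 1
      push_cast
      field_simp
      ring
    · push_cast
      field_simp
      ring_nf
      positivity
  have h2 : ∑ k ∈ block α n, -((1 - Real.exp (-1)) * (c * (1 - n * f₀ k ^ 2))) =
      -(d * ∑ k ∈ block α n, (1 - n * f₀ k ^ 2)) := by
    rw [Finset.sum_neg_distrib, Finset.mul_sum, hd]
    simp only [mul_assoc]
  rw [h1, h2]
  have h3 := mul_le_mul_of_nonneg_left hn hd0.le
  have h4 := mul_le_mul_of_nonneg_left hnl hN.le
  linarith

theorem eventually_le_lintegral_posterior_risk {h : ℝ → ℝ} (hh : IsHeavyTailed h) {α β F : ℝ}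
    (hα : 0 < α) (hαβ : α < β) : ∃ c : ℝ, 0 < c ∧ ∀ f₀ ∈ sobolevBall β F, ∀ᶠ n : ℕ in atTop,
      ENNReal.ofReal (c * (n : ℝ) ^ (-(2 * α / (2 * α + 1)))) ≤
        ∫⁻ x, (∫⁻ f, l2norm (f - f₀) ^ 2 ∂(posterior (htPrior h α) n x)) ∂(dataLaw n f₀) := by
  obtain ⟨c, hc, H⟩ := exists_le_lintegral_coordPosterior_block hh hα
  refine ⟨c / 2, by positivity, fun f₀ hf₀ => ?_⟩
  filter_upwards [eventually_le_sum_block hα hαβ hf₀, eventually_ne_atTop 0] with n hn hn0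
  have hn1 : (0 : ℝ) < n := by positivity
  refine le_trans ?_ (sum_le_lintegral_posterior_risk hh α hn0 f₀ (block α n))
  refine le_trans ?_ (mul_le_mul_right (Finset.sum_le_sum fun k hk => H n hn0 k hk (f₀ k)) _)
  have h1 : c / 2 * (n : ℝ) ^ (-(2 * α / (2 * α + 1))) = (n : ℝ)⁻¹ * (c * (cutoff α n / 2)) := by
    have : (n : ℝ) ^ (-(2 * α / (2 * α + 1))) = (n : ℝ)⁻¹ * cutoff α n := by
      rw [cutoff, ← Real.rpow_neg_one, ← Real.rpow_add hn1]
      congr 1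
      field_simp
      ring
    rw [this]
    ring
  rw [h1, ENNReal.ofReal_mul (by positivity)]
  refine mul_le_mul_right ((ENNReal.ofReal_le_ofReal
    (mul_le_mul_of_nonneg_left hn hc.le)).trans ?_) _
  rw [Finset.mul_sum]
  -- Some summands may be negative; `ENNReal.ofReal` truncates them to 0, which only increases the
  -- sum.
  exact Finset.le_sum_of_subadditive _ ENNReal.ofReal_zero.le
    (fun _ _ => ENNReal.ofReal_add_le) _ _

end SeqModel

theorem theorem2 (h : ℝ → ℝ) (hh : SeqModel.IsHeavyTailed h) (α β F : ℝ)
    (hα : 0 < α) (hαβ : α < β) (hF : 0 < F) :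
    (1 / 2 < α → ∃ δ₀ : ℝ, 0 < δ₀ ∧ ∀ δ : ℝ, δ₀ ≤ δ → ∀ f₀ ∈ SeqModel.sobolevBall β F,
      Tendsto (fun n : ℕ => ∫⁻ x,
        SeqModel.posterior (SeqModel.htPrior h α) n x
          {f | SeqModel.l2norm (f - f₀) ≤
            ENNReal.ofReal ((n : ℝ) ^ (-(α / (2 * α + 1))) * Real.log n ^ (-δ))}
        ∂(SeqModel.dataLaw n f₀)) atTop (𝓝 0)) ∧
    ∃ c : ℝ, 0 < c ∧ ∀ f₀ ∈ SeqModel.sobolevBall β F, ∀ᶠ n : ℕ in atTop,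
      ENNReal.ofReal (c * (n : ℝ) ^ (-(2 * α / (2 * α + 1)))) ≤
        ∫⁻ x, (∫⁻ f, SeqModel.l2norm (f - f₀) ^ 2
          ∂(SeqModel.posterior (SeqModel.htPrior h α) n x)) ∂(SeqModel.dataLaw n f₀) := by
  -- Every `δ > 0` works, so `δ₀ = 1` is an arbitrary choice.
  refine ⟨fun _ => ⟨1, one_pos, fun δ hδ f₀ hf₀ => ?_⟩, ?_⟩
  · exact SeqModel.tendsto_lintegral_posterior_ball hh hα hαβ hf₀ (one_pos.trans_le hδ)
  · exact SeqModel.eventually_le_lintegral_posterior_risk hh hα hαβ
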